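/- Let $\mathbb{K}$ be $\mathbb{R}$ or $\mathbb{C}$, let $n\ge 3$, and let $r_1,\dots,r_n\in\mathbb{K}$ be pairwise distinct. Let $\mathfrak{g}(n)$ be the Lie algebra over $\mathbb{K}$ given by generators $p_1,\dots,p_n$ and the relations $$[p_i,[p_j,p_k]]=0\quad\text{for pairwise distinct } i,j,k\in\{1,\dots,n\},$$ $$[p_i,[p_i,p_k]]-[p_j,[p_j,p_k]]=(r_j-r_i)\,p_k\quad\text{for } i,j,k\in\{1,\dots,n\},\ i\ne k,\ j\ne k.$$ Let $\mathfrak{so}_{n,1}\subset\mathfrak{gl}_{n+1}(\mathbb{K})$ be the Lie algebra of matrices that are skew-adjoint with respect to the bilinear form with matrix $\mathrm{diag}(1,\dots,1,-1)$, and let $E_{i,j}$ denote the matrix units. Let $\mathcal{Q}=\mathbb{K}[\lambda_1,\dots,\lambda_n]/\mathcal{I}$, where $\mathcal{I}$ is the ideal generated by $\lambda_i^2-\lambda_j^2+r_i-r_j$ for $i,j=1,\dots,n$, and let $\hat\lambda_i\in\mathcal{Q}$ be the class of $\lambda_i$. Equip $\mathfrak{so}_{n,1}\otimes_{\mathbb{K}}\mathcal{Q}$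 with the Lie bracket over $\mathbb{K}$ given by $[M_1\otimes h_1,M_2\otimes h_2]=[M_1,M_2]\otimes h_1h_2$, and let $L(n)$ be its Lie subalgebra over $\mathbb{K}$ generated by $$Q_i=(E_{i,n+1}+E_{n+1,i})\otimes\hat\lambda_i,\qquad i=1,\dots,n.$$ Then there is a unique homomorphism of Lie algebras $\varphi\colon\mathfrak{g}(n)\to L(n)$ with $\varphi(p_i)=Q_i$ for $i=1,\dots,n$, and it is an isomorphism. In particular, the Lie algebra $L(n)$ is finitely presented. -/

import Mathlib

open scoped TensorProduct

namespace MultiLL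

attribute [local instance 100] LieRing.ofAssociativeRing

/-- The defining relators, inside the free Lie algebra on `p_1, …, p_n`, of the Lie algebra `𝔤(n)`:
`[p_i,[p_j,p_k]]` for pairwise distinct `i, j, k`, and
`[p_i,[p_i,p_k]] - [p_j,[p_j,p_k]] - (r_j - r_i) p_k` for `i ≠ k`, `j ≠ k`. -/
noncomputable def relators {𝕂 : Type*} [Field 𝕂] {n : ℕ} (r : Fin n → 𝕂) : Set (FreeLieAlgebra 𝕂 (Fin n)) :=
  {x | ∃ i j k : Fin n, i ≠ j ∧ j ≠ k ∧ k ≠ i ∧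
      x = ⁅FreeLieAlgebra.of 𝕂 i, ⁅FreeLieAlgebra.of 𝕂 j, FreeLieAlgebra.of 𝕂 k⁆⁆} ∪
  {x | ∃ i j k : Fin n, i ≠ k ∧ j ≠ k ∧
      x = ⁅FreeLieAlgebra.of 𝕂 i, ⁅FreeLieAlgebra.of 𝕂 i, FreeLieAlgebra.of 𝕂 k⁆⁆
        - ⁅FreeLieAlgebra.of 𝕂 j, ⁅FreeLieAlgebra.of 𝕂 j, FreeLieAlgebra.of 𝕂 k⁆⁆
        - (r j - r i) • FreeLieAlgebra.of 𝕂 k}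

/-- The Lie ideal of the free Lie algebra generated by a set of relators. -/
noncomputable abbrev relIdeal {𝕂 : Type*} [Field 𝕂] {n : ℕ} (R : Set (FreeLieAlgebra 𝕂 (Fin n))) :
    LieIdeal 𝕂 (FreeLieAlgebra 𝕂 (Fin n)) :=
  LieSubmodule.lieSpan 𝕂 (FreeLieAlgebra 𝕂 (Fin n)) R

/-- The Lie algebra with generators indexed by `Fin n` and relators `R`. -/
abbrev Presented {𝕂 : Type*} [Field 𝕂] {n : ℕ} (R : Set (FreeLieAlgebra 𝕂 (Fin n))) : Type _ :=
  FreeLieAlgebra 𝕂 (Fin n) ⧸ relIdeal R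

/-- The Lie algebra `𝔤(n)` given by generators and relations. -/
abbrev G {𝕂 : Type*} [Field 𝕂] {n : ℕ} (r : Fin n → 𝕂) : Type _ :=
  Presented (relators r)

/-- The generator `p_i` of `𝔤(n)`. -/
noncomputable def p {𝕂 : Type*} [Field 𝕂] {n : ℕ} (r : Fin n → 𝕂) (i : Fin n) : G r :=
  LieSubmodule.Quotient.mk (FreeLieAlgebra.of 𝕂 i)

/-- A Lie algebra is finitely presented if it is isomorphic to the Lie algebra given by finitely
many generators and finitely many relations. -/
def IsFinitelyPresented (𝕂 : Type*) [Field 𝕂] (L : Type*) [LieRing L] [LieAlgebra 𝕂 L] : Prop :=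
  ∃ (m : ℕ) (R : Set (FreeLieAlgebra 𝕂 (Fin m))),
    R.Finite ∧ Nonempty (Presented R ≃ₗ⁅𝕂⁆ L)

/-- `𝔰𝔬_{n,1}`, the matrices skew-adjoint for `diag (1, …, 1, -1)`. The rows and columns
`1, …, n` are the indices `Sum.inl i`, and the row and column `n + 1` is `Sum.inr ()`. -/
abbrev so (𝕂 : Type*) [Field 𝕂] (n : ℕ) :
    LieSubalgebra 𝕂 (Matrix (Fin n ⊕ Unit) (Fin n ⊕ Unit) 𝕂) :=
  LieAlgebra.Orthogonal.so' (Fin n) Unit 𝕂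

/-- The matrix `E_{i,n+1} + E_{n+1,i}`. -/
def boostMatrix (𝕂 : Type*) [Field 𝕂] {n : ℕ} (i : Fin n) :
    Matrix (Fin n ⊕ Unit) (Fin n ⊕ Unit) 𝕂 :=
  Matrix.single (Sum.inl i) (Sum.inr ()) 1 + Matrix.single (Sum.inr ()) (Sum.inl i) 1

theorem boostMatrix_mem (𝕂 : Type*) [Field 𝕂] {n : ℕ} (i : Fin n) :
    boostMatrix 𝕂 i ∈ so 𝕂 n := by
  rw [so, LieAlgebra.Orthogonal.so', mem_skewAdjointMatricesLieSubalgebra,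
    mem_skewAdjointMatricesSubmodule, Matrix.IsSkewAdjoint, Matrix.IsAdjointPair]
  ext a b
  rcases a with a | a <;> rcases b with b | b <;>
    simp [boostMatrix, LieAlgebra.Orthogonal.indefiniteDiagonal, Matrix.single_apply, eq_comm]
  split_ifs <;> simp

/-- `E_{i,n+1} + E_{n+1,i}` as an element of `𝔰𝔬_{n,1}`. -/
noncomputable def boost (𝕂 : Type*) [Field 𝕂] {n : ℕ} (i : Fin n) : so 𝕂 n :=
  ⟨boostMatrix 𝕂 i, boostMatrix_mem 𝕂 i⟩

/-- The ideal generated by `λ_i² - λ_j² + r_i - r_j` for all `i, j`. -/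
noncomputable def curveIdeal {𝕂 : Type*} [Field 𝕂] {n : ℕ} (r : Fin n → 𝕂) : Ideal (MvPolynomial (Fin n) 𝕂) :=
  Ideal.span {f | ∃ i j : Fin n, f = MvPolynomial.X i ^ 2 - MvPolynomial.X j ^ 2
    + MvPolynomial.C (r i) - MvPolynomial.C (r j)}

/-- The quotient algebra `𝒬 = 𝕂[λ_1, …, λ_n] / 𝓘`. -/
noncomputable abbrev CurveAlg {𝕂 : Type*} [Field 𝕂] {n : ℕ} (r : Fin n → 𝕂) : Type _ :=
  MvPolynomial (Fin n) 𝕂 ⧸ curveIdeal r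

/-- The class of `λ_i` in `𝒬`. -/
noncomputable def lambdaHat {𝕂 : Type*} [Field 𝕂] {n : ℕ} (r : Fin n → 𝕂) (i : Fin n) : CurveAlg r :=
  Ideal.Quotient.mk (curveIdeal r) (MvPolynomial.X i)

/-- `𝔰𝔬_{n,1} ⊗ 𝒬` with the bracket `[M₁ ⊗ h₁, M₂ ⊗ h₂] = [M₁, M₂] ⊗ h₁ h₂`, the factor `𝒬` being
written on the left. -/
noncomputable abbrev Current {𝕂 : Type*} [Field 𝕂] {n : ℕ} (r : Fin n → 𝕂) : Type _ :=
  CurveAlg r ⊗[𝕂] so 𝕂 n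

/-- The element `(E_{i,n+1} + E_{n+1,i}) ⊗ λ_i`. -/
noncomputable def Q {𝕂 : Type*} [Field 𝕂] {n : ℕ} (r : Fin n → 𝕂) (i : Fin n) : Current r :=
  lambdaHat r i ⊗ₜ[𝕂] boost 𝕂 i

/-- `L(n)`, the Lie subalgebra over `𝕂` generated by `Q_1, …, Q_n`. -/
noncomputable def L {𝕂 : Type*} [Field 𝕂] {n : ℕ} (r : Fin n → 𝕂) : LieSubalgebra 𝕂 (Current r) :=
  LieSubalgebra.lieSpan 𝕂 (Current r) (Set.range (Q r))

/-- `Q_i` as an element of `L(n)`. -/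
noncomputable def QL {𝕂 : Type*} [Field 𝕂] {n : ℕ} (r : Fin n → 𝕂) (i : Fin n) : L r :=
  ⟨Q r i, LieSubalgebra.subset_lieSpan (Set.mem_range_self i)⟩

end MultiLL

/-! In `L(n)` the element λ = λ_i² + r_i of 𝒬 does not depend on i, and ad(Q_i)² + r_i multiplies
Q_k by λ whenever i ≠ k. So `L(n)` should have as basis the elements λ^m Q_k and λ^m [Q_i, Q_j], i <
j.

The Q_i satisfy the defining relations, which gives φ; it is surjective because it hits the
generators. The content is injectivity. Inside 𝔤(n), the elements P k m standing for λ^m p_k are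
built by iterating ad(p_i)² + r_i for a chosen i = σ k. The core (`CurrentRel.step`,
`currentRel_of_relations`) is an induction on degree: the two families of relations force all
commutation relations of a current algebra among the P k m and rot i j m = [P i 0, P j m]. In
particular the choice of σ is immaterial.

Hence these elements span 𝔤(n) (`span_tower_eq_top`). Their images, with i < j, are linearly
independent: evaluate matrix entries at points of the curve over an algebraic closure
(`coeff_eq_of_current_eq_zero`). So φ is injective, and finitely many relators present `L(n)`. -/

open scoped TensorProduct

namespace MultiLL

attribute [local instance 100] LieRing.ofAssociativeRing

/-! ### Current relations by induction on degree -/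

section Tower

variable {𝕂 L ι : Type*} [Field 𝕂] [LieRing L] [LieAlgebra 𝕂 L]

/-- The bracket of the bottom element of one tower with the `m`-th element of another. -/
def rot (P : ι → ℕ → L) (i j : ι) (m : ℕ) : L := ⁅P i 0, P j m⁆

/-- The commutation relations of a current algebra of `𝔰𝔬_{n,1}`, up to degree `m`, for elements
`P i a` (thought of as `λ ^ a` times the `i`-th generator) and their brackets. -/
structure CurrentRel (r : ι → 𝕂) (P : ι → ℕ → L) (m : ℕ) : Prop where
  lie_ne : ∀ {a b : ℕ}, a + b ≤ m → ∀ {i j : ι}, i ≠ j → ⁅P i a, P j b⁆ = rot P i j (a + b)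
  lie_same : ∀ {a b : ℕ}, a + b ≤ m → ∀ i : ι, ⁅P i a, P i b⁆ = 0
  lie_rot_ne : ∀ {a b : ℕ}, a + b ≤ m → ∀ {i j k : ι}, i ≠ j → j ≠ k → k ≠ i →
    ⁅P k a, rot P i j b⁆ = 0
  lie_rot : ∀ {a b : ℕ}, a + b ≤ m → ∀ {i j : ι}, i ≠ j →
    ⁅P i a, rot P i j b⁆ = P j (a + b + 1) - r i • P j (a + b)
  rot_lie_rot : ∀ {a b : ℕ}, a + b + 1 ≤ m → ∀ {i j k : ι}, i ≠ j → j ≠ k → k ≠ i →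
    ⁅rot P i k a, rot P k j b⁆ = rot P i j (a + b + 1) - r k • rot P i j (a + b)

variable {r : ι → 𝕂} {P : ι → ℕ → L} {m : ℕ}

theorem CurrentRel.rot_swap (H : CurrentRel r P m) {a : ℕ} (ha : a ≤ m) {i j : ι} (hij : i ≠ j) :
    rot P j i a = - rot P i j a := by
  have h := H.lie_ne (a := a) (b := 0) (by omega) hij
  rw [add_zero] at h
  rw [← h, lie_skew, rot]

/-- Up to this degree, multiplication by λ may be computed through any auxiliary index k ≠ i. -/
theorem CurrentRel.succ_eq (H : CurrentRel r P m) {a : ℕ} (ha : a ≤ m) {i k : ι} (hki : k ≠ i) :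
    P i (a + 1) = ⁅P k 0, rot P k i a⁆ + r k • P i a := by
  rw [H.lie_rot (by omega) hki]
  simp

/-- Expand P i (a + 1) through the third index k; in the Jacobi identity the term with ⁅rot P k i a,
P j b⁆ vanishes. -/
theorem CurrentRel.lie_succ_ne (H : CurrentRel r P m) {a b : ℕ} (hab : a + b = m) {i j k : ι}
    (hij : i ≠ j) (hjk : j ≠ k) (hki : k ≠ i) :
    ⁅P i (a + 1), P j b⁆ = ⁅rot P i k a, rot P k j b⁆ + r k • rot P i j m := by
  have h1 : ⁅rot P k i a, P j b⁆ = 0 := by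
    rw [← lie_skew, H.lie_rot_ne (by omega) hki hij hjk, neg_zero]
  have h2 : ⁅P k 0, P j b⁆ = rot P k j b := rfl
  rw [H.succ_eq (by omega) hki, add_lie, lie_lie, h1, h2, smul_lie, H.lie_ne (by omega) hij,
    H.rot_swap (i := i) (j := k) (by omega) hki.symm, hab]
  simp

/-- Raising the degree of the first or of the second entry yields the same bracket of two `rot`s, so
a unit of degree moves freely from P i to P j, down to a = 0, where the claim is the definition of
`rot`. -/
theorem CurrentRel.lie_ne_succ (H : CurrentRel r P m) {a b : ℕ} (hab : a + b = m + 1) {i j k : ι}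
    (hij : i ≠ j) (hjk : j ≠ k) (hki : k ≠ i) :
    ⁅P i a, P j b⁆ = rot P i j (m + 1) := by
  induction a generalizing b with
  | zero => rw [show b = m + 1 by omega]; rfl
  | succ a ih =>
    rw [← ih (b := b + 1) (by omega), H.lie_succ_ne (by omega) hij hjk hki, ← lie_skew (P i a),
      H.lie_succ_ne (k := k) (by omega) hij.symm hki.symm hjk.symm,
      H.rot_swap (i := i) (j := k) (by omega) hki.symm,
      H.rot_swap (i := k) (j := j) (by omega) hjk.symm, H.rot_swap le_rfl hij]
    rw [neg_lie, lie_neg, ← lie_skew (rot P i k a)]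
    module

theorem CurrentRel.lie_succ_same (H : CurrentRel r P m) {a b : ℕ} (hab : a + b = m) {i k : ι}
    (hik : i ≠ k) :
    ⁅P k (a + 1), P k b⁆ = ⁅P i 0, P i (m + 1)⁆ - ⁅rot P i k a, rot P i k b⁆ := by
  have h1 : ⁅rot P i k a, P k b⁆ = P i (m + 1) - r k • P i m := by
    rw [← lie_skew, H.rot_swap (by omega) hik.symm, lie_neg, H.lie_rot (by omega) hik.symm,
      neg_neg, add_comm b a, hab]
  have h2 : ⁅P i 0, P k b⁆ = rot P i k b := rfl
  have h3 : ⁅P k a, P k b⁆ = 0 := H.lie_same (by omega) k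
  have h4 : ⁅P i 0, P i m⁆ = 0 := H.lie_same (by omega) i
  rw [H.succ_eq (by omega) hik, add_lie, lie_lie, h1, h2, smul_lie, h3, lie_sub, lie_smul, h4]
  simp

/-- Write x for ⁅P i 0, P i (m + 1)⁆. Antisymmetry of ⁅P k (c + 1), P k (d + 1)⁆, both orders
expanded by `lie_succ_same`, shows that moving one unit of degree between the two `rot`s costs 2x.
-/
theorem CurrentRel.rot_lie_rot_same (H : CurrentRel r P m) {c d : ℕ} (hcd : c + d = m) {i k : ι}
    (hik : i ≠ k) :
    ⁅rot P i k c, rot P i k d⁆ + (2 * c : 𝕂) • ⁅P i 0, P i (m + 1)⁆ = ⁅rot P i k 0, rot P i k m⁆ := by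
  induction c generalizing d with
  | zero => rw [show d = m by omega]; simp
  | succ c ih =>
    have h1 := H.lie_succ_same (a := c) (b := d + 1) (by omega) hik
    have h2 := H.lie_succ_same (a := d) (b := c + 1) (by omega) hik
    rw [← lie_skew] at h2
    rw [← lie_skew (rot P i k d)] at h2
    rw [← ih (d := d + 1) (by omega)]
    push_cast
    linear_combination (norm := module) -h1 - h2

variable [CharZero 𝕂]

/-- With x_i the bracket in question, x_k = -(m + 1) x_i for all i ≠ k. Going from i to k directly
and through a third index j gives -(m + 1) x_i = (m + 1)² x_i. -/
theorem CurrentRel.lie_zero_succ_same (H : CurrentRel r P m)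
    (hex : ∀ i j : ι, ∃ k, k ≠ i ∧ k ≠ j) (i : ι) : ⁅P i 0, P i (m + 1)⁆ = 0 := by
  have key : ∀ {i k : ι}, i ≠ k →
      ⁅P k 0, P k (m + 1)⁆ = (-(m + 1) : 𝕂) • ⁅P i 0, P i (m + 1)⁆ := by
    intro i k hik
    have h1 := H.rot_lie_rot_same (c := m) (d := 0) (by omega) hik
    have h2 := H.lie_succ_same (a := m) (b := 0) (by omega) hik
    rw [← lie_skew (rot P i k 0)] at h1
    rw [← lie_skew] at h2
    linear_combination (norm := module) (-1 : 𝕂) • h2 + (1 / 2 : 𝕂) • h1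
  obtain ⟨k, hk, -⟩ := hex i i
  obtain ⟨j, hji, hjk⟩ := hex i k
  have h : ((m + 1) * (m + 2) : 𝕂) • ⁅P i 0, P i (m + 1)⁆ = 0 := by
    linear_combination (norm := module) key hk.symm - key hjk - (-(m + 1) : 𝕂) • key hji.symm
  refine (smul_eq_zero.1 h).resolve_left (mul_ne_zero ?_ ?_)
  · exact_mod_cast Nat.succ_ne_zero m
  · exact_mod_cast Nat.succ_ne_zero (m + 1)

theorem CurrentRel.lie_same_succ (H : CurrentRel r P m)
    (hex : ∀ i j : ι, ∃ k, k ≠ i ∧ k ≠ j) {a b : ℕ} (hab : a + b = m + 1) (k : ι) :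
    ⁅P k a, P k b⁆ = 0 := by
  obtain ⟨i, hik, -⟩ := hex k k
  have hx := H.lie_zero_succ_same hex
  rcases a with _ | a
  · rw [show b = m + 1 by omega, hx]
  -- With x = 0 the brackets of two `rot`s agree along the antidiagonal, and reversing the
  -- antidiagonal changes the sign, so they vanish.
  · rw [H.lie_succ_same (by omega) hik, hx, zero_sub, neg_eq_zero]
    have h1 := H.rot_lie_rot_same (c := a) (d := b) (by omega) hik
    have h2 := H.rot_lie_rot_same (c := m) (d := 0) (by omega) hik
    rw [hx, smul_zero, add_zero] at h1 h2
    rw [← lie_skew] at h2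
    linear_combination (norm := module) h1 - (1 / 2 : 𝕂) • h2

/-- Three families summing to zero along simplices, each determined by the other two beyond the
simplex, vanish. -/
theorem eq_zero_of_simplex_relations {M : Type*} [AddCommGroup M] [Module 𝕂 M] (m : ℕ)
    (f g h : ℕ → M)
    (J : ∀ a b c, a + b + c = m + 1 → f a + g b + h c = 0)
    (hf : f 0 = g (m + 1) + h 1) (hg : g 0 = h (m + 1) + f 1) (hh : h 0 = f (m + 1) + g 1)
    (a : ℕ) (ha : a ≤ m + 1) : f a = 0 := by
  -- Comparing neighbouring points of the simplex shows that each family is affine, with the same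
  -- slope d for all three.
  have affine : ∀ u v w : ℕ → M, (∀ a b c, a + b + c = m + 1 → u a + v b + w c = 0) →
      ∀ a ≤ m + 1, u a = u 0 + (a : 𝕂) • (v 1 - v 0) := by
    intro u v w J a ha
    induction a with
    | zero => simp
    | succ a ih =>
      have h1 := J (a + 1) 0 (m - a) (by omega)
      have h2 := J a 1 (m - a) (by omega)
      have h3 := ih (by omega)
      push_cast
      linear_combination (norm := module) h1 - h2 + h3
  have f1 := affine f g h J
  have g1 := affine g h f (fun a b c e => by rw [← J c a b (by omega)]; abel)
  have h1 := affine h f g (fun a b c e => by rw [← J b c a (by omega)]; abel)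
  have f2 := f1 1 (by omega)
  have g2 := g1 1 (by omega)
  have h2 := h1 1 (by omega)
  have f3 := f1 (m + 1) le_rfl
  have g3 := g1 (m + 1) le_rfl
  have h3 := h1 (m + 1) le_rfl
  have J0 := J (m + 1) 0 0 (by omega)
  push_cast at f2 g2 h2 f3 g3 h3
  have e1 : g 1 - g 0 = f 1 - f 0 := by linear_combination (norm := module) -f2
  have e2 : h 1 - h 0 = f 1 - f 0 := by linear_combination (norm := module) -f2 -g2
  rw [e1] at f3
  rw [e2] at g3
  have k1 : (2 : 𝕂) • f 0 = f 1 - f 0 := by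
    linear_combination (norm := module) hf + g3 + e2 + J0 - f3
  have k2 : (2 : 𝕂) • g 0 = f 1 - f 0 := by
    linear_combination (norm := module) hg + h3 + J0 - f3
  have k3 : (2 : 𝕂) • h 0 = f 1 - f 0 := by
    linear_combination (norm := module) hh + e1 + J0
  -- The boundary relations give 2 f 0 = 2 g 0 = 2 h 0 = d, while a corner of the simplex gives f 0
  -- + g 0 + h 0 = -(m + 1) d; hence 3d = -2(m + 1) d.
  have k4 : (2 * m + 5 : 𝕂) • (f 1 - f 0) = 0 := by
    linear_combination (norm := module) (2 : 𝕂) • J0 - (2 : 𝕂) • f3 - k1 - k2 - k3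
  have k5 : f 1 - f 0 = 0 :=
    (smul_eq_zero.1 k4).resolve_left (by exact_mod_cast Nat.succ_ne_zero (2 * m + 4))
  rw [f1 a ha, e1, k5, smul_zero, add_zero]
  exact (smul_eq_zero.1 (k1.trans k5)).resolve_left two_ne_zero

/-- Brackets of two P's in degree m + 1 are settled first, and they yield those of `rot`s with a
common middle index. The vanishing for three distinct indices then follows from Jacobi. Last comes
`lie_rot`, which says that the next tower element does not depend on the index used to build it. -/
theorem CurrentRel.step (H : CurrentRel r P m) {σ : ι → ι} (hσ : ∀ k, σ k ≠ k)
    (hrec : ∀ k a, P k (a + 1) = ⁅P (σ k) 0, rot P (σ k) k a⁆ + r (σ k) • P k a)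
    (hex : ∀ i j : ι, ∃ k, k ≠ i ∧ k ≠ j) : CurrentRel r P (m + 1) := by
  have PP : ∀ {a b : ℕ}, a + b ≤ m + 1 → ∀ {i j : ι}, i ≠ j →
      ⁅P i a, P j b⁆ = rot P i j (a + b) := by
    intro a b hab i j hij
    rcases hab.lt_or_eq with hlt | heq
    · exact H.lie_ne (by omega) hij
    · obtain ⟨k, hki, hkj⟩ := hex i j
      rw [heq, H.lie_ne_succ heq hij hkj.symm hki]
  have PS : ∀ {a b : ℕ}, a + b ≤ m + 1 → ∀ i : ι, ⁅P i a, P i b⁆ = 0 := by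
    intro a b hab i
    rcases hab.lt_or_eq with hlt | heq
    · exact H.lie_same (by omega) i
    · exact H.lie_same_succ hex heq i
  have RR : ∀ {a b : ℕ}, a + b + 1 ≤ m + 1 → ∀ {i j k : ι}, i ≠ j → j ≠ k → k ≠ i →
      ⁅rot P i k a, rot P k j b⁆ = rot P i j (a + b + 1) - r k • rot P i j (a + b) := by
    intro a b hab i j k hij hjk hki
    rcases hab.lt_or_eq with hlt | heq
    · exact H.rot_lie_rot (by omega) hij hjk hki
    · have h := H.lie_succ_ne (a := a) (b := b) (by omega) hij hjk hki
      rw [H.lie_ne_succ (by omega) hij hjk hki] at h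
      rw [heq, h, show a + b = m by omega, add_sub_cancel_right]
  have swap : ∀ {a : ℕ}, a ≤ m + 1 → ∀ {i j : ι}, i ≠ j → rot P j i a = - rot P i j a := by
    intro a ha i j hij
    have h := PP (a := a) (b := 0) (by omega) hij
    rw [add_zero] at h
    rw [← h, lie_skew, rot]
  -- Jacobi alone does not kill ⁅P k a, rot P i j b⁆. Writing the `rot` as a bracket of two `rot`s
  -- through k gives further relations.
  have K : ∀ {a c d : ℕ}, a + c + d = m → ∀ {i j k : ι}, i ≠ j → j ≠ k → k ≠ i →
      ⁅P k a, rot P i j (c + d + 1)⁆ =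
        ⁅P i (a + c + 1), rot P j k d⁆ + ⁅P j (a + d + 1), rot P k i c⁆ := by
    intro a c d h i j k hij hjk hki
    have e : rot P i j (c + d + 1) = ⁅rot P i k c, rot P k j d⁆ + r k • rot P i j (c + d) := by
      rw [RR (by omega) hij hjk hki]; abel
    have e1 : ⁅P k a, rot P i k c⁆ = -(P i (a + c + 1) - r k • P i (a + c)) := by
      rw [swap (by omega) hki, lie_neg, H.lie_rot (by omega) hki]
    have e2 : ⁅P i (a + c), rot P k j d⁆ = 0 := H.lie_rot_ne (by omega) hjk.symm hij.symm hki.symm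
    have e3 : ⁅rot P i k c, P j (a + d)⁆ = 0 := by
      rw [← lie_skew, H.lie_rot_ne (by omega) hki.symm hjk.symm hij.symm, neg_zero]
    have e4 : ⁅rot P i k c, P j (a + d + 1)⁆ = ⁅P j (a + d + 1), rot P k i c⁆ := by
      rw [← lie_skew, swap (by omega) hki, lie_neg, neg_neg]
    rw [e, lie_add, lie_smul, H.lie_rot_ne (by omega) hij hjk hki, leibniz_lie, e1,
      H.lie_rot (by omega) hjk.symm, neg_lie, sub_lie, smul_lie, e2, lie_sub, lie_smul,
      e3, e4, swap (by omega) hjk, lie_neg]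
    simp
  have X : ∀ {a b : ℕ}, a + b = m + 1 → ∀ {i j k : ι}, i ≠ j → j ≠ k → k ≠ i →
      ⁅P k a, rot P i j b⁆ = 0 := by
    intro a b hab i j k hij hjk hki
    have base : ∀ {i j k : ι}, i ≠ j → j ≠ k → k ≠ i →
        ⁅P k 0, rot P i j (m + 1 - 0)⁆ = ⁅P i (m + 1), rot P j k (m + 1 - (m + 1))⁆ +
          ⁅P j 1, rot P k i (m + 1 - 1)⁆ := by
      intro i j k hij hjk hki
      simpa using K (a := 0) (c := m) (d := 0) (by omega) hij hjk hki
    -- The simplex relations are Jacobi for P i, P j, P k in total degree m + 1; the boundary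
    -- relations are `K` with c = m, a = d = 0, permuted cyclically.
    have := eq_zero_of_simplex_relations (𝕂 := 𝕂) m (fun a => ⁅P k a, rot P i j (m + 1 - a)⁆)
      (fun a => ⁅P i a, rot P j k (m + 1 - a)⁆) (fun a => ⁅P j a, rot P k i (m + 1 - a)⁆)
      (fun a b c h => by
        rw [show m + 1 - a = b + c by omega, show m + 1 - b = c + a by omega,
          show m + 1 - c = a + b by omega, ← PP (by omega) hij, ← PP (by omega) hjk,
          ← PP (by omega) hki]
        exact lie_jacobi _ _ _)
      (base hij hjk hki) (base hjk hki hij) (base hki hij hjk) a (by omega)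
    rwa [show b = m + 1 - a by omega]
  have Y0 : ∀ {a b : ℕ}, a + b = m + 1 → ∀ {i k : ι}, i ≠ k →
      ⁅P i a, rot P i k b⁆ = ⁅P i 0, rot P i k (m + 1)⁆ := by
    intro a b hab i k hik
    rw [rot, leibniz_lie, PS (by omega), zero_lie, zero_add, PP hab.le hik, hab]
  -- The degree m + 1 analogue of the second family of defining relations: λ · P k (m + 1) is the
  -- same computed through i or through j.
  have Y : ∀ {i j k : ι}, i ≠ j → j ≠ k → k ≠ i →
      ⁅P i 0, rot P i k (m + 1)⁆ + r i • P k (m + 1) =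
        ⁅P j 0, rot P j k (m + 1)⁆ + r j • P k (m + 1) := by
    intro i j k hij hjk hki
    have e : rot P i k (m + 1) = ⁅rot P i j m, rot P j k 0⁆ + r j • rot P i k m := by
      rw [RR (by omega) hki.symm hjk.symm hij.symm]; simp
    have e1 : ⁅P i 0, rot P j k 0⁆ = 0 := H.lie_rot_ne (by omega) hjk hki hij
    have e2 : ⁅P i 0, rot P i k m⁆ = P k (m + 1) - r i • P k m := by
      rw [H.lie_rot (by omega) hki.symm, zero_add]
    have e3 : ⁅P i 0, rot P i j m⁆ = P j (m + 1) - r i • P j m := by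
      rw [H.lie_rot (by omega) hij, zero_add]
    have e4 : ⁅P j m, rot P j k 0⁆ = P k (m + 1) - r j • P k m := H.lie_rot (by omega) hjk
    rw [e, lie_add, lie_smul, leibniz_lie, e1, e2, e3, sub_lie, smul_lie, e4, Y0 (by omega) hjk,
      lie_zero]
    module
  have Z : ∀ {i k : ι}, i ≠ k →
      ⁅P i 0, rot P i k (m + 1)⁆ = P k (m + 1 + 1) - r i • P k (m + 1) := by
    intro i k hik
    rw [hrec k (m + 1)]
    rcases eq_or_ne i (σ k) with rfl | h
    · abel
    · rw [← Y h (hσ k) hik.symm]; abel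
  refine ⟨PP, PS, ?_, ?_, RR⟩
  · intro a b hab i j k hij hjk hki
    rcases hab.lt_or_eq with hlt | heq
    · exact H.lie_rot_ne (by omega) hij hjk hki
    · exact X heq hij hjk hki
  · intro a b hab i j hij
    rcases hab.lt_or_eq with hlt | heq
    · exact H.lie_rot (by omega) hij
    · rw [heq, Y0 heq hij, Z hij]

theorem currentRel_of_relations {σ : ι → ι} (hσ : ∀ k, σ k ≠ k)
    (hrec : ∀ k a, P k (a + 1) = ⁅P (σ k) 0, rot P (σ k) k a⁆ + r (σ k) • P k a)
    (hex : ∀ i j : ι, ∃ k, k ≠ i ∧ k ≠ j)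
    (h3 : ∀ i j k, i ≠ j → j ≠ k → k ≠ i → ⁅P i 0, ⁅P j 0, P k 0⁆⁆ = 0)
    (h4 : ∀ i j k, i ≠ k → j ≠ k → ⁅P i 0, ⁅P i 0, P k 0⁆⁆ - ⁅P j 0, ⁅P j 0, P k 0⁆⁆
      = (r j - r i) • P k 0) (m : ℕ) : CurrentRel r P m := by
  induction m with
  | succ m ih => exact ih.step hσ hrec hex
  | zero =>
    refine ⟨?_, ?_, ?_, ?_, by omega⟩
    · intro a b hab i j _
      obtain ⟨rfl, rfl⟩ : a = 0 ∧ b = 0 := by omega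
      rfl
    · intro a b hab i
      obtain ⟨rfl, rfl⟩ : a = 0 ∧ b = 0 := by omega
      exact lie_self _
    · intro a b hab i j k hij hjk hki
      obtain ⟨rfl, rfl⟩ : a = 0 ∧ b = 0 := by omega
      exact h3 k i j hki hij hjk
    · intro a b hab i j hij
      obtain ⟨rfl, rfl⟩ : a = 0 ∧ b = 0 := by omega
      have := h4 i (σ j) j hij (hσ j)
      simp only [zero_add]
      rw [← zero_add 1, hrec, rot, rot]
      linear_combination (norm := module) this

end Tower

/-! ### Generation by brackets with generators -/

theorem lieSpan_range_freeLieAlgebra_of (R X : Type*) [CommRing R] :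
    LieSubalgebra.lieSpan R (FreeLieAlgebra R X) (Set.range (FreeLieAlgebra.of R)) = ⊤ := by
  set S := LieSubalgebra.lieSpan R (FreeLieAlgebra R X) (Set.range (FreeLieAlgebra.of R)) with hS
  let f : FreeLieAlgebra R X →ₗ⁅R⁆ S :=
    FreeLieAlgebra.lift R fun x => ⟨FreeLieAlgebra.of R x,
      LieSubalgebra.subset_lieSpan (Set.mem_range_self x)⟩
  -- By the universal property the identity factors through the subalgebra.
  have h : S.incl.comp f = LieHom.id := FreeLieAlgebra.hom_ext fun x => by simp [f]
  refine eq_top_iff.2 fun x _ => ?_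
  have hx : S.incl (f x) = x := LieHom.congr_fun h x
  rw [← hx]
  exact (f x).2

/-- A subspace containing generators and stable under bracketing with them is everything. -/
theorem submodule_eq_top_of_lie_generators {R L : Type*} [CommRing R] [LieRing L] [LieAlgebra R L]
    {s : Set L} (hs : LieSubalgebra.lieSpan R L s = ⊤) (V : Submodule R L)
    (hV : ∀ x ∈ s, x ∈ V) (hlie : ∀ x ∈ s, ∀ v ∈ V, ⁅x, v⁆ ∈ V) : V = ⊤ := by
  -- Stability of V under ad x is carried along with membership, since the bracket case needs both.
  have key : ∀ x ∈ LieSubalgebra.lieSpan R L s, x ∈ V ∧ ∀ v ∈ V, ⁅x, v⁆ ∈ V := by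
    intro x hx
    induction hx using LieSubalgebra.lieSpan_induction with
    | mem x h => exact ⟨hV x h, hlie x h⟩
    | zero => exact ⟨V.zero_mem, fun v _ => by simp⟩
    | add x y _ _ hx hy =>
      exact ⟨V.add_mem hx.1 hy.1, fun v hv => by
        rw [add_lie]; exact V.add_mem (hx.2 v hv) (hy.2 v hv)⟩
    | smul a x _ hx =>
      exact ⟨V.smul_mem a hx.1, fun v hv => by rw [smul_lie]; exact V.smul_mem a (hx.2 v hv)⟩
    | lie x y _ _ hx hy =>
      exact ⟨hx.2 y hy.1, fun v hv => by
        rw [lie_lie]; exact V.sub_mem (hx.2 _ (hy.2 v hv)) (hy.2 _ (hx.2 v hv))⟩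
  exact eq_top_iff.2 fun x _ => (key x (hs ▸ LieSubalgebra.mem_top x)).1

/-! ### Lie algebras given by generators and relators -/

section Presentation

variable {𝕂 L : Type*} [Field 𝕂] [LieRing L] [LieAlgebra 𝕂 L] {n : ℕ}

/-- The quotient map from the free Lie algebra to a presented one. -/
noncomputable def presentedMk (R : Set (FreeLieAlgebra 𝕂 (Fin n))) :
    FreeLieAlgebra 𝕂 (Fin n) →ₗ⁅𝕂⁆ Presented R :=
  { (LieSubmodule.Quotient.mk' (relIdeal R) : FreeLieAlgebra 𝕂 (Fin n) →ₗ[𝕂] Presented R) with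
    map_lie' := fun {_ _} => rfl }

theorem presentedMk_surjective (R : Set (FreeLieAlgebra 𝕂 (Fin n))) :
    Function.Surjective (presentedMk R) :=
  LieSubmodule.Quotient.surjective_mk' (relIdeal R)

theorem presentedMk_eq_zero {R : Set (FreeLieAlgebra 𝕂 (Fin n))} {x : FreeLieAlgebra 𝕂 (Fin n)}
    (hx : x ∈ R) : presentedMk R x = 0 :=
  (LieSubmodule.Quotient.mk_eq_zero (N := relIdeal R)).2 (LieSubmodule.subset_lieSpan hx)

/-- The homomorphism from a presented Lie algebra given by images of the generators. -/
noncomputable def presentedLift {R : Set (FreeLieAlgebra 𝕂 (Fin n))} (f : Fin n → L)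
    (hf : ∀ x ∈ R, FreeLieAlgebra.lift 𝕂 f x = 0) : Presented R →ₗ⁅𝕂⁆ L :=
  { (relIdeal R).toSubmodule.liftQ (FreeLieAlgebra.lift 𝕂 f : FreeLieAlgebra 𝕂 (Fin n) →ₗ[𝕂] L)
      (fun x hx => by
        have h : relIdeal R ≤ (FreeLieAlgebra.lift 𝕂 f).ker :=
          LieSubmodule.lieSpan_le.2 fun y hy => by
            rw [SetLike.mem_coe, LieHom.mem_ker]; exact hf y hy
        exact LieHom.mem_ker.1 (h hx)) with
    map_lie' := fun {x y} => by
      obtain ⟨x, rfl⟩ := presentedMk_surjective R x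
      obtain ⟨y, rfl⟩ := presentedMk_surjective R y
      exact LieHom.map_lie (FreeLieAlgebra.lift 𝕂 f) x y }

theorem presentedLift_mk {R : Set (FreeLieAlgebra 𝕂 (Fin n))} (f : Fin n → L)
    (hf : ∀ x ∈ R, FreeLieAlgebra.lift 𝕂 f x = 0) (i : Fin n) :
    presentedLift f hf (presentedMk R (FreeLieAlgebra.of 𝕂 i)) = f i :=
  FreeLieAlgebra.lift_of_apply f i

theorem presented_hom_ext {R : Set (FreeLieAlgebra 𝕂 (Fin n))} {f g : Presented R →ₗ⁅𝕂⁆ L}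
    (h : ∀ i, f (presentedMk R (FreeLieAlgebra.of 𝕂 i)) =
      g (presentedMk R (FreeLieAlgebra.of 𝕂 i))) : f = g := by
  have e : f.comp (presentedMk R) = g.comp (presentedMk R) := FreeLieAlgebra.hom_ext h
  ext x
  obtain ⟨x, rfl⟩ := presentedMk_surjective R x
  exact LieHom.congr_fun e x

theorem lieSpan_range_presentedMk_of (R : Set (FreeLieAlgebra 𝕂 (Fin n))) :
    LieSubalgebra.lieSpan 𝕂 (Presented R)
      (Set.range fun i => presentedMk R (FreeLieAlgebra.of 𝕂 i)) = ⊤ := by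
  rw [show (Set.range fun i => presentedMk R (FreeLieAlgebra.of 𝕂 i)) =
      presentedMk R '' Set.range (FreeLieAlgebra.of 𝕂) from Set.range_comp _ _,
    ← LieSubalgebra.map_lieSpan, lieSpan_range_freeLieAlgebra_of]
  refine eq_top_iff.2 fun x _ => ?_
  obtain ⟨x, rfl⟩ := presentedMk_surjective R x
  exact ⟨x, LieSubalgebra.mem_top x, rfl⟩

variable (r : Fin n → 𝕂)

theorem lift_relators_eq_zero {f : Fin n → L}
    (h3 : ∀ i j k, i ≠ j → j ≠ k → k ≠ i → ⁅f i, ⁅f j, f k⁆⁆ = 0)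
    (h4 : ∀ i j k, i ≠ k → j ≠ k → ⁅f i, ⁅f i, f k⁆⁆ - ⁅f j, ⁅f j, f k⁆⁆ = (r j - r i) • f k) :
    ∀ x ∈ relators r, FreeLieAlgebra.lift 𝕂 f x = 0 := by
  rintro x (⟨i, j, k, hij, hjk, hki, rfl⟩ | ⟨i, j, k, hik, hjk, rfl⟩)
  · simp [h3 i j k hij hjk hki]
  · simp only [map_sub, LieHom.map_lie, map_smul, FreeLieAlgebra.lift_of_apply]
    rw [h4 i j k hik hjk, sub_self]

theorem p_lie_p_lie_p {i j k : Fin n} (hij : i ≠ j) (hjk : j ≠ k) (hki : k ≠ i) :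
    ⁅p r i, ⁅p r j, p r k⁆⁆ = 0 :=
  presentedMk_eq_zero (R := relators r) (Or.inl ⟨i, j, k, hij, hjk, hki, rfl⟩)

theorem p_lie_p_lie_sub {i j k : Fin n} (hik : i ≠ k) (hjk : j ≠ k) :
    ⁅p r i, ⁅p r i, p r k⁆⁆ - ⁅p r j, ⁅p r j, p r k⁆⁆ = (r j - r i) • p r k :=
  sub_eq_zero.1 (presentedMk_eq_zero (R := relators r) (Or.inr ⟨i, j, k, hik, hjk, rfl⟩))

theorem relators_finite : (relators r).Finite := by
  refine Set.Finite.union ?_ ?_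
  · refine (Set.finite_range fun t : Fin n × Fin n × Fin n => ⁅FreeLieAlgebra.of 𝕂 t.1,
      ⁅FreeLieAlgebra.of 𝕂 t.2.1, FreeLieAlgebra.of 𝕂 t.2.2⁆⁆).subset ?_
    rintro x ⟨i, j, k, -, -, -, rfl⟩
    exact ⟨(i, j, k), rfl⟩
  · refine (Set.finite_range fun t : Fin n × Fin n × Fin n =>
      ⁅FreeLieAlgebra.of 𝕂 t.1, ⁅FreeLieAlgebra.of 𝕂 t.1, FreeLieAlgebra.of 𝕂 t.2.2⁆⁆
        - ⁅FreeLieAlgebra.of 𝕂 t.2.1, ⁅FreeLieAlgebra.of 𝕂 t.2.1, FreeLieAlgebra.of 𝕂 t.2.2⁆⁆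
        - (r t.2.1 - r t.1) • FreeLieAlgebra.of 𝕂 t.2.2).subset ?_
    rintro x ⟨i, j, k, -, -, rfl⟩
    exact ⟨(i, j, k), rfl⟩

end Presentation

/-! ### Brackets in the current algebra and points of the curve -/

section Current

variable {𝕂 : Type*} [Field 𝕂] {n : ℕ}

theorem coe_boost_lie_boost (i j : Fin n) :
    ((⁅boost 𝕂 i, boost 𝕂 j⁆ : so 𝕂 n) : Matrix (Fin n ⊕ Unit) (Fin n ⊕ Unit) 𝕂) =
      Matrix.single (Sum.inl i) (Sum.inl j) 1 - Matrix.single (Sum.inl j) (Sum.inl i) 1 := by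
  rw [LieSubalgebra.coe_bracket, Ring.lie_def]
  simp only [boost, boostMatrix, add_mul, mul_add]
  rcases eq_or_ne i j with rfl | h
  · simp
  · simp [Matrix.single_mul_single_of_ne, h, h.symm]

theorem boost_lie_boost_lie_boost_same {i k : Fin n} (h : i ≠ k) :
    ⁅boost 𝕂 i, ⁅boost 𝕂 i, boost 𝕂 k⁆⁆ = boost 𝕂 k := by
  apply Subtype.ext
  rw [LieSubalgebra.coe_bracket, coe_boost_lie_boost, Ring.lie_def]
  simp [boost, boostMatrix, add_mul, mul_add, sub_mul, mul_sub, Matrix.single_mul_single_of_ne, h,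
    h.symm, add_comm]

theorem boost_lie_boost_lie_boost_ne {i j k : Fin n} (hij : i ≠ j) (hki : k ≠ i) :
    ⁅boost 𝕂 i, ⁅boost 𝕂 j, boost 𝕂 k⁆⁆ = 0 := by
  apply Subtype.ext
  rw [LieSubalgebra.coe_bracket, coe_boost_lie_boost, Ring.lie_def]
  simp [boost, boostMatrix, add_mul, mul_add, sub_mul, mul_sub, Matrix.single_mul_single_of_ne,
    hij, hij.symm, hki, hki.symm]

variable (r : Fin n → 𝕂)

/-- Turns scalars into ring elements, so that identities in 𝒬 become commutative ring identities. -/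
theorem curveAlg_smul_def (a : 𝕂) (q : CurveAlg r) :
    a • q = algebraMap 𝕂 (CurveAlg r) a * q := by
  obtain ⟨q, rfl⟩ := Ideal.Quotient.mk_surjective q
  change Ideal.Quotient.mk _ (a • q) =
    Ideal.Quotient.mk _ (MvPolynomial.C a) * Ideal.Quotient.mk _ q
  rw [← map_mul, MvPolynomial.smul_eq_C_mul]

theorem lambdaHat_sq_add (i j : Fin n) :
    lambdaHat r i ^ 2 + algebraMap 𝕂 (CurveAlg r) (r i) =
      lambdaHat r j ^ 2 + algebraMap 𝕂 (CurveAlg r) (r j) := by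
  have h : (Ideal.Quotient.mk (curveIdeal r)) (MvPolynomial.X i ^ 2 - MvPolynomial.X j ^ 2
      + MvPolynomial.C (r i) - MvPolynomial.C (r j)) = 0 :=
    Ideal.Quotient.eq_zero_iff_mem.2 (Ideal.subset_span ⟨i, j, rfl⟩)
  simp only [map_sub, map_add, map_pow] at h
  change lambdaHat r i ^ 2 - lambdaHat r j ^ 2 + algebraMap 𝕂 (CurveAlg r) (r i)
    - algebraMap 𝕂 (CurveAlg r) (r j) = 0 at h
  linear_combination h

theorem Q_lie_Q (i j : Fin n) :
    ⁅Q r i, Q r j⁆ = (lambdaHat r i * lambdaHat r j) ⊗ₜ[𝕂] ⁅boost 𝕂 i, boost 𝕂 j⁆ := rfl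

theorem Q_lie_tmul_ne {i j k : Fin n} (hij : i ≠ j) (hki : k ≠ i) (q : CurveAlg r) :
    ⁅Q r i, q ⊗ₜ[𝕂] ⁅boost 𝕂 j, boost 𝕂 k⁆⁆ = 0 := by
  rw [Q, LieAlgebra.ExtendScalars.bracket_tmul, boost_lie_boost_lie_boost_ne hij hki,
    TensorProduct.tmul_zero]

theorem Q_lie_tmul_same {i k : Fin n} (h : i ≠ k) (q : CurveAlg r) :
    ⁅Q r i, q ⊗ₜ[𝕂] ⁅boost 𝕂 i, boost 𝕂 k⁆⁆ = (lambdaHat r i * q) ⊗ₜ[𝕂] boost 𝕂 k := by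
  rw [Q, LieAlgebra.ExtendScalars.bracket_tmul, boost_lie_boost_lie_boost_same h]

theorem Q_lie_Q_lie_Q {i j k : Fin n} (hij : i ≠ j) (hki : k ≠ i) :
    ⁅Q r i, ⁅Q r j, Q r k⁆⁆ = 0 := by
  rw [Q_lie_Q, Q_lie_tmul_ne r hij hki]

theorem Q_lie_Q_lie_sub {i j k : Fin n} (hik : i ≠ k) (hjk : j ≠ k) :
    ⁅Q r i, ⁅Q r i, Q r k⁆⁆ - ⁅Q r j, ⁅Q r j, Q r k⁆⁆ = (r j - r i) • Q r k := by
  rw [Q_lie_Q, Q_lie_Q, Q_lie_tmul_same r hik, Q_lie_tmul_same r hjk, ← TensorProduct.sub_tmul, Q,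
    TensorProduct.smul_tmul']
  congr 1
  rw [curveAlg_smul_def, map_sub]
  linear_combination lambdaHat r k * lambdaHat_sq_add r i j

/-- The point of the curve over an algebraic closure with given value of `λ_i ^ 2 + r_i`. -/
theorem exists_curve_point (t : 𝕂) :
    ∃ χ : CurveAlg r →ₐ[𝕂] AlgebraicClosure 𝕂, ∀ i,
      χ (lambdaHat r i) ^ 2 = algebraMap 𝕂 (AlgebraicClosure 𝕂) (t - r i) := by
  choose s hs using fun i => IsAlgClosed.exists_pow_nat_eq
    (algebraMap 𝕂 (AlgebraicClosure 𝕂) (t - r i)) (n := 2) two_pos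
  refine ⟨Ideal.Quotient.liftₐ (curveIdeal r) (MvPolynomial.aeval s) fun a ha => ?_, fun i => ?_⟩
  · have h : curveIdeal r ≤ RingHom.ker (MvPolynomial.aeval (R := 𝕂) s) := by
      refine Ideal.span_le.2 ?_
      rintro f ⟨i, j, rfl⟩
      simp [hs]
    exact h ha
  · rw [← hs i]
    congr 1
    exact MvPolynomial.aeval_X s i

/-- Evaluation of a matrix entry of a current at a point of the curve. -/
noncomputable def entryEval {A : Type*} [CommRing A] [Algebra 𝕂 A] (χ : CurveAlg r →ₐ[𝕂] A)
    (a b : Fin n ⊕ Unit) : Current r →ₗ[𝕂] A :=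
  LinearMap.mul' 𝕂 A ∘ₗ TensorProduct.map χ.toLinearMap
    (Algebra.linearMap 𝕂 A ∘ₗ Matrix.entryLinearMap 𝕂 𝕂 a b ∘ₗ (so 𝕂 n).toSubmodule.subtype)

theorem entryEval_tmul {A : Type*} [CommRing A] [Algebra 𝕂 A] (χ : CurveAlg r →ₐ[𝕂] A)
    (a b : Fin n ⊕ Unit) (q : CurveAlg r) (M : so 𝕂 n) :
    entryEval r χ a b (q ⊗ₜ[𝕂] M) = χ q * algebraMap 𝕂 A (M.1 a b) := rfl

end Current

/-! ### Towers span the Lie algebra -/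

section Tower

variable {𝕂 L ι : Type*} [Field 𝕂] [LieRing L] [LieAlgebra 𝕂 L]

/-- The elements obtained from `p k` by iterating `x ↦ [p_i, [p_i, x]] + r_i x` for a chosen
`i = σ k`; in a current algebra this is multiplication by `λ_i ^ 2 + r_i`. -/
def tower (r : ι → 𝕂) (p : ι → L) (σ : ι → ι) (k : ι) : ℕ → L
  | 0 => p k
  | m + 1 => ⁅p (σ k), ⁅p (σ k), tower r p σ k m⁆⁆ + r (σ k) • tower r p σ k m

/-- A Lie algebra whose generators satisfy the relations of `𝔤(n)` is spanned by the towers and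
their brackets with the generators. -/
theorem span_tower_eq_top [CharZero 𝕂] {r : ι → 𝕂} {p : ι → L} {σ : ι → ι}
    (H : ∀ m, CurrentRel r (tower r p σ) m)
    (hp : LieSubalgebra.lieSpan 𝕂 L (Set.range p) = ⊤) :
    Submodule.span 𝕂 ({x | ∃ k m, x = tower r p σ k m} ∪
      {x | ∃ i j m, x = rot (tower r p σ) i j m}) = ⊤ := by
  set V := Submodule.span 𝕂 ({x | ∃ k m, x = tower r p σ k m} ∪
      {x | ∃ i j m, x = rot (tower r p σ) i j m}) with hV
  have hP : ∀ k m, tower r p σ k m ∈ V := fun k m => Submodule.subset_span (Or.inl ⟨k, m, rfl⟩)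
  have hR : ∀ i j m, rot (tower r p σ) i j m ∈ V := fun i j m =>
    Submodule.subset_span (Or.inr ⟨i, j, m, rfl⟩)
  refine submodule_eq_top_of_lie_generators hp V ?_ ?_
  · rintro _ ⟨k, rfl⟩
    exact hP k 0
  · rintro _ ⟨k, rfl⟩ v hv
    have key : ∀ i j m, i ≠ j → k ≠ j → ⁅p k, rot (tower r p σ) i j m⁆ ∈ V := by
      intro i j m hij hkj
      rcases eq_or_ne k i with rfl | hki
      · have h := (H m).lie_rot (a := 0) (b := m) (by omega) hij
        change ⁅p k, _⁆ = _ at h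
        rw [h]
        exact V.sub_mem (hP _ _) (V.smul_mem _ (hP _ _))
      · have h := (H m).lie_rot_ne (a := 0) (b := m) (by omega) hij hkj.symm hki
        change ⁅p k, _⁆ = _ at h
        rw [h]
        exact V.zero_mem
    induction hv using Submodule.span_induction with
    | zero => simp
    | add x y _ _ hx hy => rw [lie_add]; exact V.add_mem hx hy
    | smul a x _ hx => rw [lie_smul]; exact V.smul_mem a hx
    | mem x hx =>
      rcases hx with ⟨j, m, rfl⟩ | ⟨i, j, m, rfl⟩
      · exact hR k j m
      · rcases eq_or_ne i j with rfl | hij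
        · have h : rot (tower r p σ) i i m = 0 := (H m).lie_same (a := 0) (by omega) i
          rw [h, lie_zero]
          exact V.zero_mem
        · rcases eq_or_ne k j with rfl | hkj
          · rw [(H m).rot_swap le_rfl hij.symm, lie_neg]
            exact V.neg_mem (key k i m hij.symm hij.symm)
          · exact key i j m hij hkj

/-- Packs a linear combination of tower elements into polynomials in λ: `constr` sends X^m to the
m-th element of the family, so f k plays the role of f_k(λ) applied to P k 0. -/
theorem exists_polynomial_combination [Fintype ι] (P : ι → ℕ → L)
    (h : Submodule.span 𝕂 ({x | ∃ k m, x = P k m} ∪ {x | ∃ i j m, x = rot P i j m}) = ⊤) (x : L) :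
    ∃ (f : ι → Polynomial 𝕂) (g : ι → ι → Polynomial 𝕂),
      x = ∑ k, (Polynomial.basisMonomials 𝕂).constr 𝕂 (P k) (f k) +
        ∑ i, ∑ j, (Polynomial.basisMonomials 𝕂).constr 𝕂 (rot P i j) (g i j) := by
  classical
  have hx : x ∈ Submodule.span 𝕂 ({x | ∃ k m, x = P k m} ∪ {x | ∃ i j m, x = rot P i j m}) :=
    h ▸ Submodule.mem_top
  induction hx using Submodule.span_induction with
  | zero => exact ⟨0, 0, by simp⟩
  | add x y _ _ hx hy =>
    obtain ⟨f, g, rfl⟩ := hx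
    obtain ⟨f', g', rfl⟩ := hy
    refine ⟨f + f', g + g', ?_⟩
    simp only [Pi.add_apply, map_add, Finset.sum_add_distrib]
    abel
  | smul a x _ hx =>
    obtain ⟨f, g, rfl⟩ := hx
    refine ⟨a • f, a • g, ?_⟩
    simp only [Pi.smul_apply, map_smul, Finset.smul_sum, smul_add]
  | mem x hx =>
    have hc : ∀ (v : ℕ → L) (m : ℕ),
        (Polynomial.basisMonomials 𝕂).constr 𝕂 v (Polynomial.monomial m 1) = v m := by
      intro v m
      have h := (Polynomial.basisMonomials 𝕂).constr_basis 𝕂 v m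
      rwa [Polynomial.coe_basisMonomials] at h
    rcases hx with ⟨k, m, rfl⟩ | ⟨i, j, m, rfl⟩
    · refine ⟨Pi.single k (Polynomial.monomial m 1), 0, ?_⟩
      rw [Finset.sum_eq_single k (fun b _ hb => by rw [Pi.single_eq_of_ne hb, map_zero])
        (fun hk => absurd (Finset.mem_univ k) hk), Pi.single_eq_same, hc]
      simp
    · refine ⟨0, Pi.single i (Pi.single j (Polynomial.monomial m 1)), ?_⟩
      have hi : ∀ a, a ≠ i → ∑ b, (Polynomial.basisMonomials 𝕂).constr 𝕂 (rot P a b)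
          ((Pi.single i (Pi.single j (Polynomial.monomial m 1)) : ι → ι → Polynomial 𝕂) a b) = 0 := by
        intro a ha
        simp only [Pi.single_eq_of_ne ha, Pi.zero_apply, map_zero, Finset.sum_const_zero]
      simp only [Pi.zero_apply, map_zero, Finset.sum_const_zero, zero_add]
      rw [Fintype.sum_eq_single i hi, Pi.single_eq_same,
        Finset.sum_eq_single j (fun b _ hb => by rw [Pi.single_eq_of_ne hb, map_zero])
        (fun hk => absurd (Finset.mem_univ j) hk), Pi.single_eq_same, hc]

end Tower

/-! ### Independence of the images and injectivity -/

section Injectivity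

variable {𝕂 : Type*} [Field 𝕂] {n : ℕ} (r : Fin n → 𝕂)

/-- The class in `𝒬` of `λ_i ^ 2 + r_i`, which does not depend on `i`. -/
noncomputable def spectral (i : Fin n) : CurveAlg r :=
  lambdaHat r i ^ 2 + algebraMap 𝕂 (CurveAlg r) (r i)

theorem tower_Q {σ : Fin n → Fin n} (hσ : ∀ k, σ k ≠ k) (i k : Fin n) (m : ℕ) :
    tower r (Q r) σ k m = (spectral r i ^ m * lambdaHat r k) ⊗ₜ[𝕂] boost 𝕂 k := by
  induction m with
  | zero => simp [tower, Q]
  | succ m ih =>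
    have h : ⁅Q r (σ k), (spectral r i ^ m * lambdaHat r k) ⊗ₜ[𝕂] boost 𝕂 k⁆ =
        (lambdaHat r (σ k) * (spectral r i ^ m * lambdaHat r k)) ⊗ₜ[𝕂]
          ⁅boost 𝕂 (σ k), boost 𝕂 k⁆ := rfl
    rw [tower, ih, h, Q_lie_tmul_same r (hσ k), TensorProduct.smul_tmul',
      ← TensorProduct.add_tmul]
    congr 1
    have e : spectral r i = lambdaHat r (σ k) ^ 2 + algebraMap 𝕂 (CurveAlg r) (r (σ k)) :=
      lambdaHat_sq_add r i (σ k)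
    rw [curveAlg_smul_def]
    linear_combination -(spectral r i ^ m * lambdaHat r k) * e

theorem rot_tower_Q {σ : Fin n → Fin n} (hσ : ∀ k, σ k ≠ k) (l i j : Fin n) (m : ℕ) :
    rot (tower r (Q r) σ) i j m =
      (spectral r l ^ m * (lambdaHat r i * lambdaHat r j)) ⊗ₜ[𝕂] ⁅boost 𝕂 i, boost 𝕂 j⁆ := by
  rw [rot, tower_Q r hσ l j m, tower, Q, LieAlgebra.ExtendScalars.bracket_tmul]
  congr 1
  ring

theorem map_tower {L L' ι : Type*} [LieRing L] [LieAlgebra 𝕂 L] [LieRing L'] [LieAlgebra 𝕂 L']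
    (φ : L →ₗ⁅𝕂⁆ L') (r : ι → 𝕂) (p : ι → L) (σ : ι → ι) (k : ι) (m : ℕ) :
    φ (tower r p σ k m) = tower r (fun i => φ (p i)) σ k m := by
  induction m with
  | zero => rfl
  | succ m ih => simp only [tower, map_add, map_smul, LieHom.map_lie, ih]

theorem map_rot {L L' ι : Type*} [LieRing L] [LieAlgebra 𝕂 L] [LieRing L'] [LieAlgebra 𝕂 L']
    (φ : L →ₗ⁅𝕂⁆ L') (P : ι → ℕ → L) (i j : ι) (m : ℕ) :
    φ (rot P i j m) = rot (fun k a => φ (P k a)) i j m :=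
  LieHom.map_lie φ _ _

theorem map_constr_basisMonomials {M A N : Type*} [AddCommGroup M] [Module 𝕂 M] [CommRing A]
    [Algebra 𝕂 A] [AddCommGroup N] [Module 𝕂 N] (φ : M →ₗ[𝕂] A ⊗[𝕂] N) {v : ℕ → M} {s c : A} {y : N}
    (h : ∀ m, φ (v m) = (s ^ m * c) ⊗ₜ[𝕂] y) (f : Polynomial 𝕂) :
    φ ((Polynomial.basisMonomials 𝕂).constr 𝕂 v f) = (Polynomial.aeval s f * c) ⊗ₜ[𝕂] y := by
  have e : φ ∘ₗ (Polynomial.basisMonomials 𝕂).constr 𝕂 v =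
      (TensorProduct.mk 𝕂 A N).flip y ∘ₗ LinearMap.mulRight 𝕂 c ∘ₗ
        (Polynomial.aeval s).toLinearMap :=
    (Polynomial.basisMonomials 𝕂).ext fun m => by
      rw [LinearMap.comp_apply, Module.Basis.constr_basis, h]
      simp
  exact LinearMap.congr_fun e f

/-- Points where some λ_i = 0 carry no information on the coefficients; multiplying by h absorbs
these exceptional t. -/
theorem eq_zero_of_spectral_eval [Infinite 𝕂] {f h : Polynomial 𝕂} (hh : h ≠ 0)
    (hf : ∀ t, h.eval t ≠ 0 → f.eval t = 0) : f = 0 := by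
  refine (mul_eq_zero.1 (Polynomial.funext (p := f * h) (q := 0) fun t => ?_)).resolve_right hh
  rw [Polynomial.eval_mul, Polynomial.eval_zero, mul_eq_zero]
  exact or_iff_not_imp_right.2 (hf t)

theorem boost_inl_inr (k a : Fin n) :
    (boost 𝕂 k).1 (Sum.inl a) (Sum.inr ()) = if k = a then 1 else 0 := by
  simp [boost, boostMatrix, Matrix.single_apply]

theorem boost_inl_inl (k a b : Fin n) : (boost 𝕂 k).1 (Sum.inl a) (Sum.inl b) = 0 := by
  simp [boost, boostMatrix]

theorem boost_lie_boost_inl_inr (i j a : Fin n) :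
    (⁅boost 𝕂 i, boost 𝕂 j⁆ : so 𝕂 n).1 (Sum.inl a) (Sum.inr ()) = 0 := by
  rw [coe_boost_lie_boost]
  simp

theorem boost_lie_boost_inl_inl (i j a b : Fin n) :
    (⁅boost 𝕂 i, boost 𝕂 j⁆ : so 𝕂 n).1 (Sum.inl a) (Sum.inl b) =
      (if i = a then if j = b then 1 else 0 else 0) -
        (if j = a then if i = b then 1 else 0 else 0) := by
  rw [coe_boost_lie_boost]
  simp [Matrix.single_apply, ite_and]

/-- Polynomial combinations of the basic currents vanish only for trivial reasons. -/
theorem coeff_eq_of_current_eq_zero [Infinite 𝕂] (l : Fin n) (f : Fin n → Polynomial 𝕂)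
    (g : Fin n → Fin n → Polynomial 𝕂)
    (h : ∑ k, (Polynomial.aeval (spectral r l) (f k) * lambdaHat r k) ⊗ₜ[𝕂] boost 𝕂 k +
      ∑ i, ∑ j, (Polynomial.aeval (spectral r l) (g i j) * (lambdaHat r i * lambdaHat r j)) ⊗ₜ[𝕂]
        ⁅boost 𝕂 i, boost 𝕂 j⁆ = 0) :
    f = 0 ∧ ∀ i j, g i j = g j i := by
  -- A point of the curve over λ = t, where λ_i takes a square root of t - r_i as its value.
  have hχ : ∀ t : 𝕂, ∃ χ : CurveAlg r →ₐ[𝕂] AlgebraicClosure 𝕂,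
      (∀ q : Polynomial 𝕂, χ (Polynomial.aeval (spectral r l) q) =
        algebraMap 𝕂 (AlgebraicClosure 𝕂) (q.eval t)) ∧
      ∀ i, t - r i ≠ 0 → χ (lambdaHat r i) ≠ 0 := by
    intro t
    obtain ⟨χ, hχ⟩ := exists_curve_point r t
    refine ⟨χ, fun q => ?_, fun i hi h0 => ?_⟩
    · have e : χ (spectral r l) = algebraMap 𝕂 (AlgebraicClosure 𝕂) t := by
        rw [spectral, map_add, map_pow, hχ, AlgHom.commutes, ← map_add, sub_add_cancel]
      rw [← Polynomial.aeval_algHom_apply, e, Polynomial.aeval_algebraMap_apply,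
        Polynomial.coe_aeval_eq_eval]
    · have := hχ i
      rw [h0, zero_pow two_ne_zero] at this
      exact hi ((map_eq_zero _).1 this.symm)
  constructor
  · funext a
    refine eq_zero_of_spectral_eval (Polynomial.X_sub_C_ne_zero (r a)) fun t ht => ?_
    obtain ⟨χ, h1, h2⟩ := hχ t
    -- Only f_a(t) λ_a survives in this entry.
    have e := congrArg (entryEval r χ (Sum.inl a) (Sum.inr ())) h
    simp only [map_add, map_sum, entryEval_tmul, boost_inl_inr, boost_lie_boost_inl_inr, map_zero,
      mul_zero, Finset.sum_const_zero, add_zero, map_mul, h1, apply_ite (algebraMap 𝕂 _), map_one,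
      mul_ite, mul_one, Finset.sum_ite_eq', Finset.mem_univ, if_true] at e
    refine (map_eq_zero (algebraMap 𝕂 (AlgebraicClosure 𝕂))).1
      ((mul_eq_zero.1 e).resolve_right (h2 a ?_))
    simpa using ht
  · intro a b
    rw [← sub_eq_zero]
    refine eq_zero_of_spectral_eval (mul_ne_zero (Polynomial.X_sub_C_ne_zero (r a))
      (Polynomial.X_sub_C_ne_zero (r b))) fun t ht => ?_
    obtain ⟨χ, h1, h2⟩ := hχ t
    -- This entry is (g_ab(t) - g_ba(t)) λ_a λ_b. Symmetry of g is all that can be expected, as the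
    -- sum runs over ordered pairs of an antisymmetric family.
    have e := congrArg (entryEval r χ (Sum.inl a) (Sum.inl b)) h
    simp only [map_add, map_sum, entryEval_tmul, boost_inl_inl, boost_lie_boost_inl_inl, map_zero,
      mul_zero, Finset.sum_const_zero, zero_add, map_mul, h1, map_sub, apply_ite (algebraMap 𝕂 _),
      map_one, mul_sub, mul_ite, mul_one, Finset.sum_sub_distrib, Finset.sum_ite_eq',
      Finset.sum_ite_irrel, Finset.mem_univ, if_true] at e
    simp only [Polynomial.eval_mul, Polynomial.eval_sub, Polynomial.eval_X, Polynomial.eval_C,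
      mul_ne_zero_iff] at ht
    refine (map_eq_zero (algebraMap 𝕂 (AlgebraicClosure 𝕂))).1
      ((mul_eq_zero.1 (?_ : _ * (χ (lambdaHat r a) * χ (lambdaHat r b)) = 0)).resolve_right
        (mul_ne_zero (h2 a ht.1) (h2 b ht.2)))
    rw [Polynomial.eval_sub, map_sub]
    linear_combination e

theorem hom_injective_of_map_p [CharZero 𝕂] (hn : 3 ≤ n) (φ : G r →ₗ⁅𝕂⁆ Current r)
    (hφ : ∀ i, φ (p r i) = Q r i) : Function.Injective φ := by
  have hex : ∀ i j : Fin n, ∃ k, k ≠ i ∧ k ≠ j := by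
    intro i j
    have : (({i, j} : Finset (Fin n))ᶜ).Nonempty := by
      rw [← Finset.card_pos, Finset.card_compl, Fintype.card_fin]
      have := Finset.card_le_two (a := i) (b := j)
      omega
    obtain ⟨k, hk⟩ := this
    exact ⟨k, by simpa using hk⟩
  choose σ hσ' using fun k => hex k k
  have hσ : ∀ k, σ k ≠ k := fun k => (hσ' k).1
  let P := tower r (p r) σ
  have H : ∀ m, CurrentRel r P m := currentRel_of_relations hσ (fun _ _ => rfl) hex
    (fun _ _ _ => p_lie_p_lie_p r) (fun _ _ _ => p_lie_p_lie_sub r)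
  -- Any index would do: `spectral r l` does not depend on l.
  let l : Fin n := ⟨0, by omega⟩
  have hφP : ∀ k m, φ (P k m) = tower r (Q r) σ k m := fun k m => by
    rw [map_tower, funext hφ]
  have map_P : ∀ k f, φ ((Polynomial.basisMonomials 𝕂).constr 𝕂 (P k) f) =
      (Polynomial.aeval (spectral r l) f * lambdaHat r k) ⊗ₜ[𝕂] boost 𝕂 k := fun k =>
    map_constr_basisMonomials (φ : G r →ₗ[𝕂] Current r) fun m => by
      rw [LieHom.coe_toLinearMap, hφP, tower_Q r hσ l]
  have map_R : ∀ i j f, φ ((Polynomial.basisMonomials 𝕂).constr 𝕂 (rot P i j) f) =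
      (Polynomial.aeval (spectral r l) f * (lambdaHat r i * lambdaHat r j)) ⊗ₜ[𝕂]
        ⁅boost 𝕂 i, boost 𝕂 j⁆ := fun i j =>
    map_constr_basisMonomials (φ : G r →ₗ[𝕂] Current r) fun m => by
      rw [LieHom.coe_toLinearMap, map_rot]
      simp only [hφP]
      exact rot_tower_Q r hσ l i j m
  refine (injective_iff_map_eq_zero φ).2 fun x hx => ?_
  obtain ⟨f, g, rfl⟩ := exists_polynomial_combination P
    (span_tower_eq_top H (lieSpan_range_presentedMk_of (relators r))) x
  simp only [map_add, map_sum, map_P, map_R] at hx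
  obtain ⟨rfl, hg⟩ := coeff_eq_of_current_eq_zero r l f g hx
  -- Symmetric coefficients against the antisymmetric `rot` make the double sum equal to its own
  -- negative.
  have hS : ∀ i j, (Polynomial.basisMonomials 𝕂).constr 𝕂 (rot P i j) (g i j) =
      - (Polynomial.basisMonomials 𝕂).constr 𝕂 (rot P j i) (g j i) := by
    intro i j
    have e : rot P i j = fun m => - rot P j i m := by
      funext m
      rcases eq_or_ne i j with rfl | hij
      · have h : rot P i i m = 0 := (H m).lie_same (a := 0) (by omega) i
        rw [h, neg_zero]
      · exact (H m).rot_swap le_rfl hij.symm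
    rw [e, hg i j]
    simp [Module.Basis.constr_apply, Finsupp.sum, Finset.sum_neg_distrib]
  have hS' : ∑ i, ∑ j, (Polynomial.basisMonomials 𝕂).constr 𝕂 (rot P i j) (g i j) = 0 := by
    set S := ∑ i, ∑ j, (Polynomial.basisMonomials 𝕂).constr 𝕂 (rot P i j) (g i j) with hSdef
    have h1 : S = -S := by
      conv_lhs => rw [hSdef, Finset.sum_comm]
      simp only [hSdef, ← Finset.sum_neg_distrib, ← hS]
    have h2 : (2 : 𝕂) • S = 0 := by
      rw [two_smul]
      nth_rewrite 1 [h1]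
      exact neg_add_cancel S
    exact (smul_eq_zero.1 h2).resolve_left two_ne_zero
  rw [hS']
  simp

end Injectivity

end MultiLL

/-! ### The isomorphism and finite presentation -/

theorem theorem4p2 {𝕂 : Type*} [RCLike 𝕂] (n : ℕ) (hn : 3 ≤ n) (r : Fin n → 𝕂)
    (hr : ∀ i j : Fin n, i ≠ j → r i ≠ r j) :
    (∃ φ : MultiLL.G r →ₗ⁅𝕂⁆ MultiLL.L r,
      (∀ i, φ (MultiLL.p r i) = MultiLL.QL r i) ∧
      (∀ ψ : MultiLL.G r →ₗ⁅𝕂⁆ MultiLL.L r,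
        (∀ i, ψ (MultiLL.p r i) = MultiLL.QL r i) → ψ = φ) ∧
      Function.Bijective φ) ∧
    MultiLL.IsFinitelyPresented 𝕂 (MultiLL.L r) := by
  have hrel := MultiLL.lift_relators_eq_zero r (f := MultiLL.QL r)
    (fun i j k hij _ hki => Subtype.ext (MultiLL.Q_lie_Q_lie_Q r hij hki))
    (fun i j k hik hjk => Subtype.ext (MultiLL.Q_lie_Q_lie_sub r hik hjk))
  let φ : MultiLL.G r →ₗ⁅𝕂⁆ MultiLL.L r := MultiLL.presentedLift (MultiLL.QL r) hrel
  have hφ : ∀ i, φ (MultiLL.p r i) = MultiLL.QL r i := MultiLL.presentedLift_mk _ hrel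
  have hinj : Function.Injective φ := by
    have h := MultiLL.hom_injective_of_map_p r hn ((MultiLL.L r).incl.comp φ) fun i =>
      congrArg Subtype.val (hφ i)
    exact Function.Injective.of_comp (f := (MultiLL.L r).incl) h
  have hsurj : Function.Surjective φ := by
    have hle : MultiLL.L r ≤ ((MultiLL.L r).incl.comp φ).range := by
      refine LieSubalgebra.lieSpan_le.2 ?_
      rintro _ ⟨i, rfl⟩
      exact ⟨MultiLL.p r i, congrArg Subtype.val (hφ i)⟩
    intro y
    obtain ⟨x, hx⟩ := hle y.2
    exact ⟨x, Subtype.ext hx⟩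
  exact ⟨⟨φ, hφ, fun ψ hψ => MultiLL.presented_hom_ext fun i => (hψ i).trans (hφ i).symm,
    hinj, hsurj⟩, n, MultiLL.relators r, MultiLL.relators_finite r,
    ⟨LieEquiv.ofBijective φ ⟨hinj, hsurj⟩⟩⟩
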